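/- For a Borel probability measure $\nu$ on $\mathbb C$ with compact support let $I(\nu)=\iint\log|z-w|\,d\nu(z)\,d\nu(w)\in[-\infty,\infty)$. For a set $B\subset\mathbb C$ let $\operatorname{Cap}(B)=\exp\big(\sup_\nu I(\nu)\big)$, where $\nu$ runs over the Borel probability measures with compact support contained in $B$ (with $\sup\emptyset=-\infty$, $e^{-\infty}=0$); $B$ is called non-polar if $\operatorname{Cap}(B)>0$. Let $\mathcal B$ be the set of Borel probability measures $\mu$ on $\mathbb C$ whose support $S(\mu)$ is compact and non-polar. For $\mu\in\mathcal B$ let $\Omega(\mu)$ be the unbounded connected component of $\mathbb C\setminus S(\mu)$, let $K(\mu)=\mathbb C\setminus\Omega(\mu)$, and let $P_n(z)=\gamma_nz^n+\dots$ ($n\ge 0$, $\gamma_n>0$) be the orthonormal polynomials of $\mu$ in $L^2(\mu)$. For $n\ge2$ let $K_n=\mathbb C\setminus\{z : P_n^{k}(z)\to\infty \text{ as } k\to\infty\}$ be the filled Julia set of $P_n$, where $P_n^{k}$ is the $k$-th iterate of $P_n$. Let $\mu\in\mathcal B$ and let $V\subset\mathbb C$ be a compact set with $V\cap K(\mu)=\emptyset$.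 Then there exists $M\in\mathbb N$ such that for every $n\ge2$ and every $z\in K_n$ the number of solutions $w\in V$ of $P_n(w)=z$, counted with multiplicity, is less than $M$. In particular $\#\big(P_n^{-1}(z)\cap V\big)<M$. -/

import Mathlib

open MeasureTheory Filter Topology Polynomial
open scoped ENNReal

namespace OrthoJulia

noncomputable section

/-! ### Logarithmic potential theory -/

/-- The logarithmic kernel `log |z - w|`, with value `-∞` on the diagonal. -/
def logKernel (x : ℂ × ℂ) : EReal := ENNReal.log (edist x.1 x.2)

/-- The logarithmic energy `I(ν) = ∬ log |z - w| dν(z) dν(w) ∈ [-∞, ∞)` of a compactly supported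
probability measure: integral of the positive part minus integral of the negative part
(the former is finite when the support is compact). -/
def logEnergy (ν : Measure ℂ) : EReal :=
  ((∫⁻ x, (logKernel x).toENNReal ∂(ν.prod ν) : ℝ≥0∞) : EReal) -
    ((∫⁻ x, (-logKernel x).toENNReal ∂(ν.prod ν) : ℝ≥0∞) : EReal)

/-- The energy of a set: the supremum of the energies of the Borel probability measures with
compact support contained in the set. -/
def setEnergy (B : Set ℂ) : EReal :=
  ⨆ ν ∈ {ν : Measure ℂ | IsProbabilityMeasure ν ∧ IsCompact ν.support ∧ ν.support ⊆ B},
    logEnergy ν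

/-- Logarithmic capacity `Cap(B) = exp (I(B))`. -/
def logCap (B : Set ℂ) : ℝ≥0∞ := EReal.exp (setEnergy B)

/-- A set is polar if its logarithmic capacity vanishes. -/
def IsPolar (B : Set ℂ) : Prop := logCap B = 0

/-- The class `𝓑` of Borel probability measures on `ℂ` with compact non-polar support. -/
def classB : Set (Measure ℂ) :=
  {μ | IsProbabilityMeasure μ ∧ IsCompact μ.support ∧ ¬ IsPolar μ.support}

/-- The unbounded connected component `Ω(S)` of the complement of a compact set `S`: the points
of the complement whose connected component in the complement is unbounded. -/
def unboundedComponent (S : Set ℂ) : Set ℂ :=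
  {z | z ∈ Sᶜ ∧ ¬ Bornology.IsBounded (connectedComponentIn Sᶜ z)}

/-- The filled set `K(S) = ℂ ∖ Ω(S)` (polynomially convex hull) of a compact set `S`. -/
def filled (S : Set ℂ) : Set ℂ := (unboundedComponent S)ᶜ

/-! ### Orthonormal polynomials -/

/-- The `L²(μ)` inner product of polynomials, conjugate-linear in the first argument. -/
def polyInner (μ : Measure ℂ) (p q : ℂ[X]) : ℂ :=
  ∫ z, (starRingEnd ℂ) (p.eval z) * q.eval z ∂μ

/-- The monic orthogonal polynomials of `μ`, by the Gram-Schmidt process applied to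
`1, z, z², …`. -/
def monicOrthoPoly (μ : Measure ℂ) (n : ℕ) : ℂ[X] :=
  X ^ n - ∑ k : Fin n,
    C (polyInner μ (monicOrthoPoly μ k) (X ^ n) /
      polyInner μ (monicOrthoPoly μ k) (monicOrthoPoly μ k)) * monicOrthoPoly μ k
termination_by n
decreasing_by all_goals exact k.2

/-- The orthonormal polynomials `P_n(μ; z) = γ_n z^n + …` of `μ`, with `γ_n > 0`. -/
def orthoPoly (μ : Measure ℂ) (n : ℕ) : ℂ[X] :=
  C (((Real.sqrt (∫ z, ‖(monicOrthoPoly μ n).eval z‖ ^ 2 ∂μ))⁻¹ : ℝ) : ℂ) * monicOrthoPoly μ n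

/-! ### Polynomial dynamics -/

/-- The basin of attraction of `∞` for a polynomial. -/
def basinOfInfinity (P : ℂ[X]) : Set ℂ :=
  {z | Tendsto (fun k : ℕ => (fun w => P.eval w)^[k] z) atTop (Bornology.cobounded ℂ)}

/-- The filled Julia set of a polynomial. -/
def filledJulia (P : ℂ[X]) : Set ℂ := (basinOfInfinity P)ᶜ

open Classical in
/-- The number of solutions `w ∈ V` of `P(w) = z`, counted with multiplicity
(for non-constant `P`). -/
def preimageCount (P : ℂ[X]) (z : ℂ) (V : Set ℂ) : ℕ := (P - C z).roots.countP (· ∈ V)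

/-! ### The polynomials `orthoPoly μ n` are the orthonormal polynomials of `μ` -/

theorem support_infinite_of_mem_classB {μ : Measure ℂ} (hμ : μ ∈ classB) :
    μ.support.Infinite := by
  intro hfin
  refine hμ.2.2 ?_
  have h : setEnergy μ.support = ⊥ := by
    refine le_bot_iff.1 (iSup₂_le fun ν hν => ?_)
    obtain ⟨h1, -, h3⟩ := hν
    have hf : ν.support.Finite := hfin.subset h3
    obtain ⟨a, -, ha⟩ : ∃ a ∈ ν.support, ν {a} ≠ 0 := by
      by_contra! hcon
      have h0 : ν ν.support = 0 := by
        rw [← Set.biUnion_of_singleton ν.support]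
        exact (measure_biUnion_null_iff hf.countable).2 hcon
      have h2 : ν Set.univ = 0 := by
        rw [← Set.union_compl_self ν.support]
        exact measure_union_null h0 Measure.measure_compl_support
      simp at h2
    have htop : (∫⁻ x, (-logKernel x).toENNReal ∂(ν.prod ν) : ℝ≥0∞) = ⊤ := by
      refine top_le_iff.1 ?_
      calc (⊤ : ℝ≥0∞) = (-logKernel (a, a)).toENNReal * (ν.prod ν) {(a, a)} := by
            rw [← Set.singleton_prod_singleton, Measure.prod_prod]
            simp [logKernel, ENNReal.top_mul, ha]
        _ = ∫⁻ x in {(a, a)}, (-logKernel x).toENNReal ∂(ν.prod ν) := by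
            rw [Measure.restrict_singleton, lintegral_smul_measure, lintegral_dirac, smul_eq_mul,
              mul_comm]
        _ ≤ _ := setLIntegral_le_lintegral _ _
    rw [logEnergy, htop]
    simp
  simp [IsPolar, logCap, h]

theorem integrable_of_continuous {μ : Measure ℂ} [IsFiniteMeasure μ] (hc : IsCompact μ.support)
    {E : Type*} [NormedAddCommGroup E] {f : ℂ → E} (hf : Continuous f) : Integrable f μ := by
  have h : IntegrableOn f μ.support μ := hf.continuousOn.integrableOn_compact hc
  rwa [IntegrableOn, Measure.restrict_eq_self_of_ae_mem] at h
  exact Measure.support_mem_ae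

theorem integrable_polyInner {μ : Measure ℂ} [IsFiniteMeasure μ] (hc : IsCompact μ.support)
    (p q : ℂ[X]) : Integrable (fun z => (starRingEnd ℂ) (p.eval z) * q.eval z) μ :=
  integrable_of_continuous hc
    ((Complex.continuous_conj.comp p.continuous).mul q.continuous)

theorem polyInner_conj (μ : Measure ℂ) (p q : ℂ[X]) :
    (starRingEnd ℂ) (polyInner μ p q) = polyInner μ q p := by
  rw [polyInner, polyInner, ← integral_conj]
  congr 1
  ext z
  simp [mul_comm]

theorem polyInner_C_mul (μ : Measure ℂ) (p q : ℂ[X]) (c : ℂ) :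
    polyInner μ p (C c * q) = c * polyInner μ p q := by
  rw [polyInner, polyInner, ← integral_const_mul]
  congr 1
  ext z
  simp only [eval_mul, eval_C]
  ring

theorem polyInner_self (μ : Measure ℂ) (p : ℂ[X]) :
    polyInner μ p p = ((∫ z, ‖p.eval z‖ ^ 2 ∂μ : ℝ) : ℂ) := by
  rw [polyInner, ← integral_complex_ofReal]
  congr 1
  ext z
  rw [mul_comm, Complex.mul_conj, Complex.normSq_eq_norm_sq]

theorem integral_norm_sq_pos {μ : Measure ℂ} [IsFiniteMeasure μ] (hc : IsCompact μ.support)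
    (hinf : μ.support.Infinite) {p : ℂ[X]} (hp : p ≠ 0) : 0 < ∫ z, ‖p.eval z‖ ^ 2 ∂μ := by
  refine (integral_nonneg fun z => by positivity).lt_of_ne fun h => ?_
  have h1 := (integral_eq_zero_iff_of_nonneg (fun z => sq_nonneg _)
    (integrable_of_continuous hc (p.continuous.norm.pow 2))).1 h.symm
  have h2 : {z : ℂ | p.eval z = 0} ∈ ae μ := by
    filter_upwards [h1] with z hz
    simpa using hz
  have h3 : IsClosed {z : ℂ | p.eval z = 0} := isClosed_eq p.continuous continuous_const
  refine hinf ((p.roots.toFinset.finite_toSet).subset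
    ((Measure.support_subset_of_isClosed h3 h2).trans fun z hz => ?_))
  simpa [hp] using hz

theorem monicOrthoPoly_monic (μ : Measure ℂ) (n : ℕ) :
    (monicOrthoPoly μ n).Monic ∧ (monicOrthoPoly μ n).natDegree = n := by
  induction n using Nat.strong_induction_on with
  | _ n ih =>
    have hlt : (∑ k : Fin n, C (polyInner μ (monicOrthoPoly μ k) (X ^ n) /
        polyInner μ (monicOrthoPoly μ k) (monicOrthoPoly μ k)) * monicOrthoPoly μ k).degree
        < (n : WithBot ℕ) := by
      refine (degree_sum_le _ _).trans_lt ((Finset.sup_lt_iff (WithBot.bot_lt_coe n)).2 ?_)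
      intro k _
      rw [← smul_eq_C_mul]
      refine (degree_smul_le _ _).trans_lt ?_
      rw [degree_eq_natDegree (ih k k.2).1.ne_zero, (ih k k.2).2]
      exact WithBot.coe_lt_coe.2 k.2
    rw [monicOrthoPoly]
    have hm := monic_X_pow_sub hlt
    refine ⟨hm, natDegree_eq_of_degree_eq_some ?_⟩
    rw [degree_sub_eq_left_of_degree_lt (by rwa [degree_X_pow]), degree_X_pow]

theorem polyInner_monicOrthoPoly {μ : Measure ℂ} [IsFiniteMeasure μ] (hc : IsCompact μ.support)
    (hinf : μ.support.Infinite) (n : ℕ) :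
    ∀ m < n, polyInner μ (monicOrthoPoly μ m) (monicOrthoPoly μ n) = 0 := by
  induction n using Nat.strong_induction_on with
  | _ n ih =>
    intro m hm
    have hne : polyInner μ (monicOrthoPoly μ m) (monicOrthoPoly μ m) ≠ 0 := by
      rw [polyInner_self]
      exact_mod_cast (integral_norm_sq_pos hc hinf (monicOrthoPoly_monic μ m).1.ne_zero).ne'
    have hsum : ∀ f : Fin n → ℂ[X], polyInner μ (monicOrthoPoly μ m) (X ^ n - ∑ k, f k) =
        polyInner μ (monicOrthoPoly μ m) (X ^ n) -
          ∑ k, polyInner μ (monicOrthoPoly μ m) (f k) := by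
      intro f
      simp only [polyInner]
      rw [← integral_finsetSum _ fun k _ => integrable_polyInner hc _ _,
        ← integral_sub (integrable_polyInner hc _ _)
          (integrable_finsetSum _ fun k _ => integrable_polyInner hc _ _)]
      congr 1
      ext z
      simp only [eval_sub, eval_finsetSum, mul_sub, Finset.mul_sum]
    rw [monicOrthoPoly.eq_def μ n, hsum, Finset.sum_eq_single (⟨m, hm⟩ : Fin n)]
    · rw [polyInner_C_mul, div_mul_cancel₀ _ hne, sub_self]
    · intro k _ hk
      rw [polyInner_C_mul]
      have hkm : (k : ℕ) ≠ m := fun h => hk (Fin.ext h)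
      rcases lt_or_gt_of_ne hkm with h | h
      · rw [← polyInner_conj μ (monicOrthoPoly μ k) (monicOrthoPoly μ m), ih m hm k h, map_zero,
          mul_zero]
      · rw [ih k k.2 m h, mul_zero]
    · simp

/-- For `μ` with infinite compact support, `orthoPoly μ` is an orthonormal sequence in `L²(μ)`
whose `n`-th member has degree `n` and positive leading coefficient. -/
theorem orthoPoly_spec {μ : Measure ℂ} [IsFiniteMeasure μ] (hc : IsCompact μ.support)
    (hinf : μ.support.Infinite) :
    (∀ n, (orthoPoly μ n).natDegree = n ∧
      ∃ γ : ℝ, 0 < γ ∧ (orthoPoly μ n).leadingCoeff = (γ : ℂ)) ∧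
    ∀ m n, polyInner μ (orthoPoly μ m) (orthoPoly μ n) = if m = n then 1 else 0 := by
  have hpos : ∀ n, 0 < ∫ z, ‖(monicOrthoPoly μ n).eval z‖ ^ 2 ∂μ := fun n =>
    integral_norm_sq_pos hc hinf (monicOrthoPoly_monic μ n).1.ne_zero
  have hinner : ∀ m n, m ≠ n →
      polyInner μ (monicOrthoPoly μ m) (monicOrthoPoly μ n) = 0 := by
    intro m n h
    rcases lt_or_gt_of_ne h with h | h
    · exact polyInner_monicOrthoPoly hc hinf n m h
    · rw [← polyInner_conj, polyInner_monicOrthoPoly hc hinf m n h, map_zero]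
  refine ⟨fun n => ?_, fun m n => ?_⟩
  · have hg : 0 < (Real.sqrt (∫ z, ‖(monicOrthoPoly μ n).eval z‖ ^ 2 ∂μ))⁻¹ :=
      inv_pos.2 (Real.sqrt_pos.2 (hpos n))
    refine ⟨?_, _, hg, ?_⟩
    · rw [orthoPoly, natDegree_C_mul (by exact_mod_cast hg.ne'), (monicOrthoPoly_monic μ n).2]
    · rw [orthoPoly, leadingCoeff_mul, leadingCoeff_C, (monicOrthoPoly_monic μ n).1.leadingCoeff,
        mul_one]
  · have key : ∀ a b : ℝ, polyInner μ (C (a : ℂ) * monicOrthoPoly μ m)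
        (C (b : ℂ) * monicOrthoPoly μ n) =
        a * b * polyInner μ (monicOrthoPoly μ m) (monicOrthoPoly μ n) := by
      intro a b
      rw [polyInner_C_mul, ← polyInner_conj, polyInner_C_mul, map_mul, polyInner_conj,
        Complex.conj_ofReal]
      ring
    rw [orthoPoly, orthoPoly, key]
    split_ifs with h
    · subst h
      rw [polyInner_self]
      have h1 := Real.mul_self_sqrt (hpos m).le
      have h2 := (Real.sqrt_pos.2 (hpos m)).ne'
      norm_cast
      nth_rewrite 3 [← h1]
      field_simp
    · rw [hinner m n h, mul_zero]

end

end OrthoJulia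

/-! The proof combines the extremal property of orthogonal polynomials with Widom's zero-replacement
argument. Let `S` be the support of `μ`. Among polynomials of degree `n` with leading coefficient
`γ_n`, `P_n` has the least `L²(μ)` norm, and this norm is 1. If `P_n - c` had many zeros in `V`,
those zeros could be exchanged for others so that the polynomial shrinks on `S` by a factor
`2^(-k)`, with degree and leading coefficient unchanged. Since the squared norm of `P_n - c` is at
most `2(1 + |c|²)`, a large `k` contradicts extremality, and the required `k` depends only on a
bound for `|c|`.

Two facts complete the argument. The exchange (`exists_monic_norm_eval_le_half_pow`) rests on a
Runge-type statement: for `w` in the unbounded component of the complement of `S`, the function `z -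
w` is a uniform limit on `S` of polynomials in `1/(z - w)`. Clearing denominators yields a monic `q`
with `|q| ≤ ε|z - w|^(deg q)` on `S`. The bound on `|c|` holds because the zeros of `P_n` lie in any
disc about 0 containing `S`, which makes `P_n` at least double the modulus outside a disc
independent of `n ≥ 2`; all the `K_n` lie in that disc. Non-polarity enters through the infinitude
of the support. -/

namespace OrthoJulia

/-! ### Pole pushing in commutative Banach algebras -/

section Resolvent

variable {A : Type*} [NormedCommRing A] [NormedAlgebra ℂ A]

theorem resolvent_mul_sub {a : A} {w : ℂ} (hw : w ∈ resolventSet ℂ a) :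
    resolvent a w * (algebraMap ℂ A w - a) = 1 :=
  Ring.inverse_mul_cancel _ hw

variable [CompleteSpace A]

/-- A closed subalgebra contains the Neumann inverse of `1 - t` for each of its members `t` of
norm less than one. -/
theorem mem_of_mul_one_sub_eq_one {B : Subalgebra ℂ A} (hB : IsClosed (B : Set A)) {t y : A}
    (ht : t ∈ B) (hn : ‖t‖ < 1) (hy : y * (1 - t) = 1) : y ∈ B := by
  have : CompleteSpace B := hB.completeSpace_coe
  let v : Bˣ := Units.oneSub (⟨t, ht⟩ : B) hn
  have hv : (1 - t) * ((v⁻¹ : Bˣ) : B) = 1 := congrArg (fun x : B => (x : A)) v.mul_inv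
  have : y = ((v⁻¹ : Bˣ) : B) := by
    calc y = y * ((1 - t) * ((v⁻¹ : Bˣ) : B)) := by rw [hv, mul_one]
      _ = ((v⁻¹ : Bˣ) : B) := by rw [← mul_assoc, hy, one_mul]
  rw [this]
  exact Subtype.coe_prop _

/-- The factorisation `w' - a = (w - a)(1 - (w - w')R(w))` exhibits `R(w')` as `R(w)` times a
Neumann inverse. -/
theorem resolvent_mem_elemental {a : A} {w w' : ℂ} (hw : w ∈ resolventSet ℂ a)
    (hw' : w' ∈ resolventSet ℂ a) (h : ‖(w - w') • resolvent a w‖ < 1) :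
    resolvent a w' ∈ Algebra.elemental ℂ (resolvent a w) := by
  have hR := Algebra.elemental.self_mem ℂ (resolvent a w)
  have h1 := resolvent_mul_sub hw
  have h2 := resolvent_mul_sub hw'
  have key : algebraMap ℂ A w' - a =
      (algebraMap ℂ A w - a) * (1 - (w - w') • resolvent a w) := by
    rw [Algebra.smul_def, map_sub]
    linear_combination (algebraMap ℂ A w - algebraMap ℂ A w') * h1
  have hy : (resolvent a w' * (algebraMap ℂ A w - a)) * (1 - (w - w') • resolvent a w) = 1 := by
    rw [mul_assoc, ← key, h2]
  have hmem := mem_of_mul_one_sub_eq_one (Algebra.elemental.isClosed ℂ (resolvent a w))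
    (Subalgebra.smul_mem _ hR (w - w')) h hy
  have : resolvent a w' = resolvent a w' * (algebraMap ℂ A w - a) * resolvent a w := by
    linear_combination (-resolvent a w') * h1
  rw [this]
  exact mul_mem hmem hR

/-- Each resolvent lies in the closed algebra of the other. The smallness condition for the converse
inclusion involves `R(w')`, hence the appeal to continuity of the resolvent. -/
theorem eventually_elemental_resolvent_eq {a : A} {w : ℂ} (hw : w ∈ resolventSet ℂ a) :
    ∀ᶠ w' in 𝓝 w, Algebra.elemental ℂ (resolvent a w') = Algebra.elemental ℂ (resolvent a w) := by
  have hc : ContinuousAt (resolvent a) w :=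
    (spectrum.hasDerivAt_resolvent_const_left hw).continuousAt
  have h1 : ∀ᶠ w' in 𝓝 w, ‖(w - w') • resolvent a w‖ < 1 := by
    have : ContinuousAt (fun w' => ‖(w - w') • resolvent a w‖) w := by fun_prop
    exact this.eventually_lt_const (by simp)
  have h2 : ∀ᶠ w' in 𝓝 w, ‖(w' - w) • resolvent a w'‖ < 1 := by
    have : ContinuousAt (fun w' => ‖(w' - w) • resolvent a w'‖) w := by fun_prop
    exact this.eventually_lt_const (by simp)
  filter_upwards [h1, h2, (spectrum.isOpen_resolventSet (𝕜 := ℂ) a).mem_nhds hw] with w' e1 e2 e3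
  refine le_antisymm ?_ ?_
  · exact Algebra.elemental.le_of_mem (Algebra.elemental.isClosed ℂ _)
      (resolvent_mem_elemental hw e3 e1)
  · exact Algebra.elemental.le_of_mem (Algebra.elemental.isClosed ℂ _)
      (resolvent_mem_elemental e3 hw e2)

/-- For large `w`, `w R(w) = 1 + a R(w)` is close to 1, so its inverse `w⁻¹(w - a)` is a Neumann
series in `R(w)`. The factor `1 + ‖1‖` appears because `‖1‖ = 1` is not assumed. -/
theorem mem_elemental_resolvent_of_lt_norm {a : A} {w : ℂ} (hw : w ∈ resolventSet ℂ a)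
    (h : ‖a‖ * (1 + ‖(1 : A)‖) < ‖w‖) : a ∈ Algebra.elemental ℂ (resolvent a w) := by
  have hR := Algebra.elemental.self_mem ℂ (resolvent a w)
  have h1 := resolvent_mul_sub hw
  have hw0 : w ≠ 0 := by
    rintro rfl
    rw [norm_zero] at h
    exact absurd h (not_lt.2 (by positivity))
  have e1 : w • resolvent a w = 1 + a * resolvent a w := by
    rw [Algebra.smul_def]
    linear_combination h1
  have e2 : ‖w‖ * ‖resolvent a w‖ ≤ ‖(1 : A)‖ + ‖a‖ * ‖resolvent a w‖ := by
    rw [← norm_smul, e1]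
    exact (norm_add_le _ _).trans (by gcongr; exact norm_mul_le _ _)
  have hlt : ‖1 - w • resolvent a w‖ < 1 := by
    have e3 : 1 - w • resolvent a w = -(a * resolvent a w) := by rw [e1]; ring
    rw [e3, norm_neg]
    refine (norm_mul_le _ _).trans_lt ?_
    by_contra! hcon
    have hr := norm_nonneg (resolvent a w)
    have ha := norm_nonneg a
    have h1n := norm_nonneg (1 : A)
    rcases hr.eq_or_lt with hr0 | hr0
    · rw [← hr0] at hcon
      norm_num at hcon
    · nlinarith [mul_le_mul_of_nonneg_right hcon h1n, mul_lt_mul_of_pos_right h hr0]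
  have hmem := mem_of_mul_one_sub_eq_one (y := w⁻¹ • (algebraMap ℂ A w - a))
    (Algebra.elemental.isClosed ℂ (resolvent a w))
    (sub_mem (one_mem _) (Subalgebra.smul_mem _ hR w)) hlt (by
      rw [sub_sub_cancel, smul_mul_smul_comm, inv_mul_cancel₀ hw0, one_smul, mul_comm, h1])
  have : a = algebraMap ℂ A w - w • (w⁻¹ • (algebraMap ℂ A w - a)) := by
    rw [smul_smul, mul_inv_cancel₀ hw0, one_smul, sub_sub_cancel]
  rw [this]
  refine sub_mem (Subalgebra.algebraMap_mem _ _) (Subalgebra.smul_mem _ ?_ w)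
  rwa [← this]

/-- Pole pushing: at a point of an unbounded component of the resolvent set of `a`, the element
`a` is a limit of polynomials in its resolvent. -/
theorem mem_elemental_resolvent {a : A} {w : ℂ} (hw : w ∈ resolventSet ℂ a)
    (hub : ¬ Bornology.IsBounded (connectedComponentIn (resolventSet ℂ a) w)) :
    a ∈ Algebra.elemental ℂ (resolvent a w) := by
  set D := connectedComponentIn (resolventSet ℂ a) w with hD
  have hopen := spectrum.isOpen_resolventSet (𝕜 := ℂ) a
  -- The algebra generated by `R(v)` is locally constant in `v`, so both `T` and its complement `T'`
  -- in the resolvent set are open. The connected set `D` meets `T` far out, hence lies in `T`.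
  let T : Set ℂ := {v | v ∈ resolventSet ℂ a ∧ a ∈ Algebra.elemental ℂ (resolvent a v)}
  let T' : Set ℂ := {v | v ∈ resolventSet ℂ a ∧ a ∉ Algebra.elemental ℂ (resolvent a v)}
  have hT : IsOpen T := isOpen_iff_mem_nhds.2 fun v hv => by
    filter_upwards [hopen.mem_nhds hv.1, eventually_elemental_resolvent_eq hv.1] with x h1 h2
    exact ⟨h1, h2 ▸ hv.2⟩
  have hT' : IsOpen T' := isOpen_iff_mem_nhds.2 fun v hv => by
    filter_upwards [hopen.mem_nhds hv.1, eventually_elemental_resolvent_eq hv.1] with x h1 h2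
    exact ⟨h1, h2 ▸ hv.2⟩
  have hsub : D ⊆ resolventSet ℂ a := connectedComponentIn_subset _ _
  have hne : (D ∩ T).Nonempty := by
    by_contra hcon
    refine hub (isBounded_iff_forall_norm_le.2 ⟨‖a‖ * (1 + ‖(1 : A)‖), fun v hv => ?_⟩)
    by_contra! hlt
    exact hcon ⟨v, hv, hsub hv, mem_elemental_resolvent_of_lt_norm (hsub hv) hlt⟩
  have := isPreconnected_connectedComponentIn.subset_left_of_subset_union hT hT'
    (Set.disjoint_left.2 fun v h1 h2 => h2.2 h1.2)
    (fun v hv => by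
      by_cases h : a ∈ Algebra.elemental ℂ (resolvent a v)
      · exact Or.inl ⟨hsub hv, h⟩
      · exact Or.inr ⟨hsub hv, h⟩) hne
  exact (this (mem_connectedComponentIn hw)).2

end Resolvent

/-! ### Widom's lemma on replacing zeros -/

/-- Approximation by monic polynomials relative to a power of `z - w`, for `w` in the unbounded
component of the complement of `S`. -/
theorem exists_monic_norm_eval_le_pow {S : Set ℂ} (hS : IsCompact S) {w : ℂ}
    (hw : w ∈ unboundedComponent S) {ε : ℝ} (hε : 0 < ε) :
    ∃ q : ℂ[X], q.Monic ∧ ∀ z ∈ S, ‖q.eval z‖ ≤ ε * ‖z - w‖ ^ q.natDegree := by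
  have : CompactSpace S := isCompact_iff_compactSpace.1 hS
  let a : C(S, ℂ) := ⟨Subtype.val, continuous_subtype_val⟩
  have hres : resolventSet ℂ a = Sᶜ := by
    ext v
    rw [spectrum.mem_resolventSet_iff, ContinuousMap.isUnit_iff_forall_ne_zero, Set.mem_compl_iff]
    constructor
    · intro h hv
      exact h ⟨v, hv⟩ (by simp [a])
    · rintro h ⟨x, hx⟩ h0
      have : v - x = 0 := by simpa [a] using h0
      exact h (by rwa [sub_eq_zero.1 this])
  have hwS : w ∉ S := hw.1
  have hwr : w ∈ resolventSet ℂ a := by rw [hres]; exact hwS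
  have hmem := mem_elemental_resolvent hwr (by rw [hres]; exact hw.2)
  -- With this sign, `R` is the function `1/(z - w)` on `S`.
  set R : C(S, ℂ) := -resolvent a w with hR
  have hRz : ∀ z : S, R z * ((z : ℂ) - w) = 1 := fun z => by
    have := congrArg (fun f : C(S, ℂ) => f z) (resolvent_mul_sub hwr)
    have hw' : (algebraMap ℂ C(S, ℂ) w) z = w := rfl
    have ha : a z = (z : ℂ) := rfl
    simp only [ContinuousMap.mul_apply, ContinuousMap.sub_apply, ContinuousMap.one_apply,
      hw', ha] at this
    rw [hR, ContinuousMap.neg_apply, ← this]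
    ring
  have hmem' : a - algebraMap ℂ C(S, ℂ) w ∈ Algebra.elemental ℂ R := by
    refine sub_mem ?_ (Subalgebra.algebraMap_mem _ _)
    refine Algebra.elemental.le_of_mem (Algebra.elemental.isClosed ℂ R) ?_ hmem
    rw [← neg_neg (resolvent a w)]
    exact neg_mem (Algebra.elemental.self_mem ℂ R)
  have hcl : a - algebraMap ℂ C(S, ℂ) w ∈ closure (Algebra.adjoin ℂ {R} : Set C(S, ℂ)) := hmem'
  -- The final estimate multiplies this error by `|R(z)|`; adding 1 keeps the denominator positive.
  obtain ⟨f, hf, hdist⟩ := Metric.mem_closure_iff.1 hcl (ε / (‖R‖ + 1)) (by positivity)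
  obtain ⟨p, rfl⟩ : ∃ p : ℂ[X], aeval R p = f := by
    rw [SetLike.mem_coe, Algebra.adjoin_singleton_eq_range_aeval] at hf
    exact hf
  -- With `p(1/u)` close to `u = z - w`, the quantity `1 - p(1/u)/u` is small. Multiplying it by
  -- `u^m` gives the reversed polynomial `q₀(u)`, which is monic because `1 - X p` has constant term
  -- 1.
  set m := (1 - X * p).natDegree with hm
  set q₀ := (1 - X * p).reflect m with hq₀
  have hdeg : q₀.natDegree ≤ m := (natDegree_reflect_le).trans (by simp [hm])
  have hcoeff : q₀.coeff m = 1 := by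
    rw [hq₀, coeff_reflect, revAt_le le_rfl]
    simp
  have hmonic : q₀.Monic := monic_of_natDegree_le_of_coeff_eq_one m hdeg hcoeff
  have hdeg' : q₀.natDegree = m :=
    natDegree_eq_of_le_of_coeff_ne_zero hdeg (by rw [hcoeff]; exact one_ne_zero)
  refine ⟨q₀.comp (X - C w), hmonic.comp_X_sub_C w, fun z hz => ?_⟩
  rw [natDegree_comp, natDegree_X_sub_C, mul_one, hdeg', eval_comp, eval_sub, eval_X, eval_C]
  have hz1 := hRz ⟨z, hz⟩
  set r : ℂ := R ⟨z, hz⟩ with hr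
  have hzw : z - w ≠ 0 := right_ne_zero_of_mul_eq_one hz1
  let _ : Invertible r := ⟨z - w, by rw [mul_comm]; exact hz1, hz1⟩
  have e1 : q₀.eval (z - w) * r ^ m = 1 - r * p.eval r := by
    have := eval₂_reflect_mul_pow (RingHom.id ℂ) r m (1 - X * p) le_rfl
    rwa [← hq₀, eval₂_id, eval₂_id, eval_sub, eval_one, eval_mul, eval_X] at this
  have e2 : q₀.eval (z - w) = (r * ((z - w) - p.eval r)) * (z - w) ^ m := by
    calc q₀.eval (z - w) = q₀.eval (z - w) * r ^ m * (z - w) ^ m := by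
          rw [mul_assoc, ← mul_pow, hz1, one_pow, mul_one]
      _ = _ := by rw [e1]; linear_combination (-(z - w) ^ m) * hz1
  rw [e2, norm_mul, norm_mul, norm_pow]
  gcongr
  have e3 : ‖(z - w) - p.eval r‖ ≤ ε / (‖R‖ + 1) := by
    have h1 : ((a - algebraMap ℂ C(S, ℂ) w) - aeval R p) ⟨z, hz⟩ = (z - w) - p.eval r := by
      have : (aeval R p : C(S, ℂ)) ⟨z, hz⟩ = p.eval r := by
        rw [← coe_aeval_eq_eval, hr]
        exact (aeval_algHom_apply (ContinuousMap.evalAlgHom ℂ ℂ (⟨z, hz⟩ : S)) R p).symm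
      simp [this, a]
    rw [← h1]
    exact (ContinuousMap.norm_coe_le_norm _ _).trans (by rw [← dist_eq_norm]; exact hdist.le)
  have e4 : ‖r‖ ≤ ‖R‖ := ContinuousMap.norm_coe_le_norm R _
  calc ‖r‖ * ‖(z - w) - p.eval r‖ ≤ (‖R‖ + 1) * (ε / (‖R‖ + 1)) := by
        gcongr
        linarith
    _ = ε := by field_simp

/-- If `S` keeps distance `δ` from `w`, moving `w` by less than `(1 - 1/c)δ` shrinks distances to
`S` at most by the factor `1/c`. -/
theorem exists_nhds_norm_sub_le_mul {S : Set ℂ} (hS : IsClosed S) {w : ℂ} (hw : w ∉ S) {c : ℝ}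
    (hc : 1 < c) : ∃ U ∈ 𝓝 w, ∀ x ∈ U, ∀ z ∈ S, ‖z - w‖ ≤ c * ‖z - x‖ := by
  obtain ⟨δ, hδ, hball⟩ := Metric.isOpen_iff.1 hS.isOpen_compl w hw
  have hc0 : 0 < c := by linarith
  have hη : 0 < (1 - c⁻¹) * δ := mul_pos (sub_pos.2 (inv_lt_one_of_one_lt₀ hc)) hδ
  refine ⟨_, Metric.ball_mem_nhds w hη, fun x hx z hz => ?_⟩
  have h1 : δ ≤ ‖z - w‖ := by
    by_contra! h
    exact hball (by rwa [Metric.mem_ball, dist_eq_norm]) hz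
  have h2 : ‖x - w‖ < (1 - c⁻¹) * δ := by rwa [Metric.mem_ball, dist_eq_norm] at hx
  have h3 : ‖z - w‖ ≤ ‖z - x‖ + ‖x - w‖ := by
    simpa using norm_add_le (z - x) (x - w)
  have h4 : (1 - c⁻¹) * δ ≤ (1 - c⁻¹) * ‖z - w‖ :=
    mul_le_mul_of_nonneg_left h1 (sub_pos.2 (inv_lt_one_of_one_lt₀ hc)).le
  have h5 : c⁻¹ * ‖z - w‖ ≤ ‖z - x‖ := by linarith
  rwa [inv_mul_le_iff₀ hc0] at h5

theorem pow_card_le_mul_prod {c r : ℝ} (hr : 0 ≤ r) {f : ℂ → ℝ} (t : Multiset ℂ)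
    (h : ∀ x ∈ t, r ≤ c * f x) : r ^ t.card ≤ c ^ t.card * (t.map f).prod := by
  induction t using Multiset.induction_on with
  | empty => simp
  | cons a t ih =>
    have h1 := ih fun x hx => h x (Multiset.mem_cons_of_mem hx)
    have h2 := h a (Multiset.mem_cons_self a t)
    rw [Multiset.card_cons, Multiset.map_cons, Multiset.prod_cons, pow_succ, pow_succ]
    calc r ^ t.card * r ≤ (c ^ t.card * (t.map f).prod) * (c * f a) :=
          mul_le_mul h1 h2 hr ((pow_nonneg hr _).trans h1)
      _ = _ := by ring

/-- Near a point of the unbounded component of the complement of `S`, a product of sufficiently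
many linear factors can be replaced by a monic polynomial which is half as large on `S`. -/
theorem exists_nhds_monic_norm_eval_le {S : Set ℂ} (hS : IsCompact S) {w : ℂ}
    (hw : w ∈ unboundedComponent S) :
    ∃ q : ℂ[X], q.Monic ∧ ∃ U ∈ 𝓝 w, ∀ t : Multiset ℂ, t.card = q.natDegree → (∀ x ∈ t, x ∈ U) →
      ∀ z ∈ S, ‖q.eval z‖ ≤ 1 / 2 * (t.map fun x => ‖z - x‖).prod := by
  obtain ⟨q, hq, hqS⟩ := exists_monic_norm_eval_le_pow hS hw (ε := 1 / 4) (by norm_num)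
  -- Moving all the zeros away from `w` costs at most `c ^ deg q < 2`, which turns the bound `1/4`
  -- into `1/2`.
  obtain ⟨c, hc2, hc1⟩ : ∃ c : ℝ, c ^ q.natDegree < 2 ∧ 1 < c := by
    have h1 : ContinuousAt (fun c : ℝ => c ^ q.natDegree) 1 := by fun_prop
    have h2 : ∀ᶠ c in 𝓝[>] (1 : ℝ), c ^ q.natDegree < 2 :=
      (h1.eventually_lt_const (by norm_num)).filter_mono nhdsWithin_le_nhds
    exact (h2.and self_mem_nhdsWithin).exists
  obtain ⟨U, hU, hUS⟩ := exists_nhds_norm_sub_le_mul hS.isClosed hw.1 hc1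
  refine ⟨q, hq, U, hU, fun t ht htU z hz => (hqS z hz).trans ?_⟩
  have h1 := pow_card_le_mul_prod (norm_nonneg (z - w)) (f := fun x => ‖z - x‖) t
    fun x hx => hUS x (htU x hx) z hz
  have h2 : 0 ≤ (t.map fun x => ‖z - x‖).prod :=
    Multiset.prod_nonneg fun y hy => by
      obtain ⟨x, -, rfl⟩ := Multiset.mem_map.1 hy
      exact norm_nonneg _
  rw [ht] at h1
  nlinarith [mul_le_mul_of_nonneg_right hc2.le h2]

open Classical in
-- Pigeonhole for a cover that may overlap: the counts add up to at least the cardinality.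
theorem exists_lt_countP_of_sum_lt_card {ι : Type*} (F : Finset ι) (U : ι → Set ℂ) (m : ι → ℕ)
    (s : Multiset ℂ) (hs : ∀ x ∈ s, ∃ j ∈ F, x ∈ U j) (hcard : ∑ j ∈ F, m j < s.card) :
    ∃ j ∈ F, m j < s.countP (· ∈ U j) := by
  by_contra! hcon
  have key : s.card ≤ ∑ j ∈ F, s.countP (· ∈ U j) := by
    clear hcon hcard
    induction s using Multiset.induction_on with
    | empty => simp
    | cons a s ih =>
      obtain ⟨j, hj, hja⟩ := hs a (Multiset.mem_cons_self a s)
      have h1 := ih fun x hx => hs x (Multiset.mem_cons_of_mem hx)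
      simp only [Multiset.countP_cons, Finset.sum_add_distrib, Multiset.card_cons]
      have h2 : 1 ≤ ∑ j ∈ F, if a ∈ U j then 1 else 0 := by
        calc 1 = if a ∈ U j then 1 else 0 := by rw [if_pos hja]
          _ ≤ _ := Finset.single_le_sum (f := fun j => if a ∈ U j then 1 else 0)
            (fun _ _ => Nat.zero_le _) hj
      omega
  have := Finset.sum_le_sum hcon
  omega

theorem norm_eval_multiset_prod_X_sub_C (s : Multiset ℂ) (z : ℂ) :
    ‖(s.map fun x => X - C x).prod.eval z‖ = (s.map fun x => ‖z - x‖).prod := by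
  induction s using Multiset.induction_on with
  | empty => simp
  | cons a s ih => simp [ih]

theorem exists_multiset_le_card_eq {α : Type*} {s : Multiset α} {n : ℕ} (h : n ≤ s.card) :
    ∃ t ≤ s, t.card = n := by
  have : 0 < (Multiset.powersetCard n s).card := by
    rw [Multiset.card_powersetCard]
    exact Nat.choose_pos h
  obtain ⟨t, ht⟩ := Multiset.card_pos_iff_exists_mem.1 this
  exact ⟨t, Multiset.mem_powersetCard.1 ht⟩

/-- Widom's lemma: a polynomial with many zeros in a compact subset of the unbounded component of
the complement of `S` can be replaced by one which is much smaller on `S`. -/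
theorem exists_monic_norm_eval_le_half_pow {S V : Set ℂ} (hS : IsCompact S) (hV : IsCompact V)
    (hVS : V ⊆ unboundedComponent S) :
    ∃ L : ℕ, ∀ k : ℕ, ∀ s : Multiset ℂ, (∀ x ∈ s, x ∈ V) → k * L ≤ s.card →
      ∃ q : ℂ[X], q.Monic ∧ q.natDegree = s.card ∧
        ∀ z ∈ S, ‖q.eval z‖ ≤ (1 / 2) ^ k * (s.map fun x => ‖z - x‖).prod := by
  classical
  have hloc := fun w : V => exists_nhds_monic_norm_eval_le hS (hVS w.2)
  choose q hq U hU hqU using hloc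
  obtain ⟨F, hF⟩ := hV.elim_nhds_subcover' (fun w hw => U ⟨w, hw⟩) fun w hw => hU ⟨w, hw⟩
  -- With this `L`, any `L` points of `V` crowd some `U j` enough to exchange `deg (q j)` of them.
  -- Each exchange gains a factor `1/2` and uses up fewer than `L` points.
  refine ⟨∑ j ∈ F, (q j).natDegree + 1, fun k => ?_⟩
  induction k with
  | zero =>
    intro s _ _
    refine ⟨(s.map fun x => X - C x).prod, monic_multiset_prod_of_monic _ _
      fun x _ => monic_X_sub_C x, ?_, fun z _ => ?_⟩
    · rw [natDegree_multiset_prod_X_sub_C_eq_card]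
    · rw [pow_zero, one_mul, norm_eval_multiset_prod_X_sub_C]
  | succ k ih =>
    intro s hs hcard
    obtain ⟨j, hjF, hj⟩ := exists_lt_countP_of_sum_lt_card F U (fun j => (q j).natDegree) s
      (fun x hx => by simpa using hF (hs x hx)) (by nlinarith)
    rw [Multiset.countP_eq_card_filter] at hj
    obtain ⟨t, ht, htc⟩ := exists_multiset_le_card_eq hj.le
    have hts : t ≤ s := ht.trans (Multiset.filter_le _ _)
    obtain ⟨u, rfl⟩ := Multiset.le_iff_exists_add.1 hts
    have hle : (q j).natDegree ≤ ∑ j ∈ F, (q j).natDegree :=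
      Finset.single_le_sum (f := fun j => (q j).natDegree) (fun _ _ => Nat.zero_le _) hjF
    rw [Multiset.card_add, htc] at hcard
    obtain ⟨p, hp, hpd, hpS⟩ := ih u (fun x hx => hs x (Multiset.mem_add.2 (Or.inr hx)))
      (by nlinarith)
    refine ⟨q j * p, (hq j).mul hp, ?_, fun z hz => ?_⟩
    · rw [(hq j).natDegree_mul hp, Multiset.card_add, htc, hpd]
    · have h1 := hqU j t htc (fun x hx => (Multiset.mem_filter.1 (Multiset.mem_of_le ht hx)).2) z hz
      have h2 := hpS z hz
      rw [eval_mul, norm_mul, Multiset.map_add, Multiset.prod_add]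
      calc _ ≤ _ := mul_le_mul h1 h2 (norm_nonneg _) ((norm_nonneg _).trans h1)
        _ = _ := by ring

/-! ### Orthogonality and extremality -/

theorem polyInner_add_right {μ : Measure ℂ} [IsFiniteMeasure μ] (hc : IsCompact μ.support)
    (p q r : ℂ[X]) : polyInner μ p (q + r) = polyInner μ p q + polyInner μ p r := by
  rw [polyInner, polyInner, polyInner,
    ← integral_add (integrable_polyInner hc _ _) (integrable_polyInner hc _ _)]
  congr 1
  ext z
  rw [eval_add, mul_add]

/-- Subtracting a multiple of the orthogonal polynomial of degree `d` removes the top coefficient,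
which gives an induction on `d`. -/
theorem polyInner_monicOrthoPoly_of_degree_lt {μ : Measure ℂ} [IsFiniteMeasure μ]
    (hc : IsCompact μ.support) (hinf : μ.support.Infinite) {n d : ℕ} (hd : d ≤ n) {p : ℂ[X]}
    (hp : p.degree < d) : polyInner μ (monicOrthoPoly μ n) p = 0 := by
  induction d generalizing p with
  | zero =>
    have : p = 0 := by simpa using hp
    simp [this, polyInner]
  | succ d ih =>
    obtain ⟨hm, hmd⟩ := monicOrthoPoly_monic μ d
    have hr : (p - C (p.coeff d) * monicOrthoPoly μ d).degree < d := by
      refine (degree_lt_iff_coeff_zero _ _).2 fun k hk => ?_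
      rw [coeff_sub, coeff_C_mul]
      rcases hk.eq_or_lt with rfl | hk
      · have : (monicOrthoPoly μ d).coeff d = 1 := by
          simpa [Monic, leadingCoeff, hmd] using hm
        rw [this, mul_one, sub_self]
      · rw [(degree_lt_iff_coeff_zero _ _).1 hp k hk,
          coeff_eq_zero_of_natDegree_lt (p := monicOrthoPoly μ d) (by omega), mul_zero, sub_zero]
    have h0 : polyInner μ (monicOrthoPoly μ n) (monicOrthoPoly μ d) = 0 := by
      rw [← polyInner_conj, polyInner_monicOrthoPoly hc hinf n d (by omega), map_zero]
    rw [← sub_add_cancel p (C (p.coeff d) * monicOrthoPoly μ d), polyInner_add_right hc,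
      ih (by omega) hr, polyInner_C_mul, h0, mul_zero, add_zero]

/-- Among the monic polynomials of degree `n`, the orthogonal one has minimal norm in `L²(μ)`. -/
theorem integral_norm_sq_monicOrthoPoly_le {μ : Measure ℂ} [IsFiniteMeasure μ]
    (hc : IsCompact μ.support) (hinf : μ.support.Infinite) {n : ℕ} {p : ℂ[X]} (hp : p.Monic)
    (hpn : p.natDegree = n) :
    ∫ z, ‖(monicOrthoPoly μ n).eval z‖ ^ 2 ∂μ ≤ ∫ z, ‖p.eval z‖ ^ 2 ∂μ := by
  obtain ⟨hm, hmd⟩ := monicOrthoPoly_monic μ n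
  set M := monicOrthoPoly μ n with hM
  have hr : (p - M).degree < n := by
    have := degree_sub_lt_left (p := p) (q := M)
      (by rw [degree_eq_natDegree hp.ne_zero, degree_eq_natDegree hm.ne_zero, hpn, hmd])
      hp.ne_zero (by rw [hp.leadingCoeff, hm.leadingCoeff])
    rwa [degree_eq_natDegree hp.ne_zero, hpn] at this
  -- The rest is Pythagoras for `p = M + (p - M)`.
  have h0 : polyInner μ M (p - M) = 0 :=
    polyInner_monicOrthoPoly_of_degree_lt hc hinf le_rfl hr
  have h0' : polyInner μ (p - M) M = 0 := by rw [← polyInner_conj, h0, map_zero]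
  have e1 : polyInner μ p M = polyInner μ M M := by
    rw [← polyInner_conj]
    nth_rewrite 1 [← add_sub_cancel M p]
    rw [polyInner_add_right hc, h0, add_zero, polyInner_conj]
  have e2 : polyInner μ p (p - M) = polyInner μ (p - M) (p - M) := by
    rw [← polyInner_conj μ (p - M) p]
    nth_rewrite 2 [← add_sub_cancel M p]
    rw [polyInner_add_right hc, h0', zero_add, polyInner_conj]
  have e3 : polyInner μ p p = polyInner μ M M + polyInner μ (p - M) (p - M) := by
    rw [← e1, ← e2, ← polyInner_add_right hc, add_sub_cancel]
  simp only [polyInner_self] at e3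
  have e4 : ∫ z, ‖p.eval z‖ ^ 2 ∂μ =
      ∫ z, ‖M.eval z‖ ^ 2 ∂μ + ∫ z, ‖(p - M).eval z‖ ^ 2 ∂μ := by exact_mod_cast e3
  have e5 : 0 ≤ ∫ z, ‖(p - M).eval z‖ ^ 2 ∂μ := integral_nonneg fun z => by positivity
  linarith

/-! ### Location of zeros and uniform escape -/

/-- Factor out the zero as `(X - w) q`. Orthogonality to `q` gives `⟨q, X q⟩ = w ⟨q, q⟩`, so `w` is
an average of `z` over the support with weight `|q|² dμ`. -/
theorem norm_le_of_eval_monicOrthoPoly_eq_zero {μ : Measure ℂ} [IsFiniteMeasure μ]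
    (hc : IsCompact μ.support) (hinf : μ.support.Infinite) {r : ℝ}
    (hr : ∀ z ∈ μ.support, ‖z‖ ≤ r) {n : ℕ} {w : ℂ} (hw : (monicOrthoPoly μ n).eval w = 0) :
    ‖w‖ ≤ r := by
  obtain ⟨hm, hmd⟩ := monicOrthoPoly_monic μ n
  obtain ⟨q, hq⟩ := dvd_iff_isRoot.2 hw
  have hq0 : q ≠ 0 := by
    rintro rfl
    exact hm.ne_zero (by rw [hq, mul_zero])
  have hdeg : q.degree < n := by
    rw [degree_eq_natDegree hq0, Nat.cast_lt, ← hmd, hq,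
      natDegree_mul (X_sub_C_ne_zero w) hq0, natDegree_X_sub_C]
    omega
  have h0 : polyInner μ q (monicOrthoPoly μ n) = 0 := by
    rw [← polyInner_conj, polyInner_monicOrthoPoly_of_degree_lt hc hinf le_rfl hdeg, map_zero]
  have hpos := integral_norm_sq_pos hc hinf hq0
  have h1 : polyInner μ q (X * q) = w * polyInner μ q q := by
    have : X * q = monicOrthoPoly μ n + C w * q := by rw [hq]; ring
    rw [this, polyInner_add_right hc, h0, zero_add, polyInner_C_mul]
  rw [polyInner_self] at h1
  have h2 : ‖polyInner μ q (X * q)‖ ≤ r * ∫ z, ‖q.eval z‖ ^ 2 ∂μ := by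
    rw [polyInner, ← integral_const_mul]
    refine norm_integral_le_of_norm_le
      ((integrable_of_continuous hc (q.continuous.norm.pow 2)).const_mul r) ?_
    filter_upwards [Measure.support_mem_ae (μ := μ)] with z hz
    rw [norm_mul, RCLike.norm_conj, eval_mul, eval_X, norm_mul]
    have := mul_le_mul_of_nonneg_right (hr z hz) (sq_nonneg ‖q.eval z‖)
    linarith
  rw [h1, norm_mul, Complex.norm_of_nonneg hpos.le] at h2
  exact le_of_mul_le_mul_right h2 hpos

theorem pow_sub_le_norm_eval_monicOrthoPoly {μ : Measure ℂ} [IsFiniteMeasure μ]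
    (hc : IsCompact μ.support) (hinf : μ.support.Infinite) {r : ℝ}
    (hr : ∀ z ∈ μ.support, ‖z‖ ≤ r) (n : ℕ) {z : ℂ} (hz : r ≤ ‖z‖) :
    (‖z‖ - r) ^ n ≤ ‖(monicOrthoPoly μ n).eval z‖ := by
  obtain ⟨hm, hmd⟩ := monicOrthoPoly_monic μ n
  have hcard : (monicOrthoPoly μ n).roots.card = n := by
    rw [← (IsAlgClosed.splits (monicOrthoPoly μ n)).natDegree_eq_card_roots, hmd]
  have hprod := prod_multiset_X_sub_C_of_monic_of_roots_card_eq hm (by rw [hcard, hmd])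
  have h := pow_card_le_mul_prod (c := 1) (sub_nonneg.2 hz) (f := fun x => ‖z - x‖)
    (monicOrthoPoly μ n).roots fun x hx => by
      have h1 := norm_le_of_eval_monicOrthoPoly_eq_zero hc hinf hr (isRoot_of_mem_roots hx)
      have h2 := norm_sub_norm_le z x
      linarith
  rw [one_pow, one_mul, hcard, ← norm_eval_multiset_prod_X_sub_C, hprod] at h
  exact h

theorem sqrt_integral_monicOrthoPoly_le {μ : Measure ℂ} [IsProbabilityMeasure μ]
    (hc : IsCompact μ.support) (hinf : μ.support.Infinite) {r : ℝ} (hr0 : 0 ≤ r)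
    (hr : ∀ z ∈ μ.support, ‖z‖ ≤ r) (n : ℕ) :
    Real.sqrt (∫ z, ‖(monicOrthoPoly μ n).eval z‖ ^ 2 ∂μ) ≤ r ^ n := by
  refine Real.sqrt_le_iff.2 ⟨by positivity, ?_⟩
  refine (integral_norm_sq_monicOrthoPoly_le hc hinf (monic_X_pow n) (natDegree_X_pow n)).trans ?_
  calc ∫ z, ‖(X ^ n : ℂ[X]).eval z‖ ^ 2 ∂μ ≤ ∫ _, (r ^ n) ^ 2 ∂μ := by
        refine integral_mono_ae (integrable_of_continuous hc ((X ^ n : ℂ[X]).continuous.norm.pow 2))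
          (integrable_const _) ?_
        filter_upwards [Measure.support_mem_ae (μ := μ)] with z hz
        have := hr z hz
        rw [eval_pow, eval_X, norm_pow]
        gcongr
    _ = _ := by simp

theorem norm_eval_orthoPoly (μ : Measure ℂ) (n : ℕ) (z : ℂ) : ‖(orthoPoly μ n).eval z‖ =
    (Real.sqrt (∫ z, ‖(monicOrthoPoly μ n).eval z‖ ^ 2 ∂μ))⁻¹ *
      ‖(monicOrthoPoly μ n).eval z‖ := by
  rw [orthoPoly, eval_mul, eval_C, norm_mul,
    Complex.norm_of_nonneg (inv_nonneg.2 (Real.sqrt_nonneg _))]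

/-- All `n` zeros are at distance at least `‖z‖ - r` from `z`, and comparison with `X ^ n` bounds
the normalising norm by `r ^ n`. -/
theorem pow_le_norm_eval_orthoPoly {μ : Measure ℂ} [IsProbabilityMeasure μ]
    (hc : IsCompact μ.support) (hinf : μ.support.Infinite) {r : ℝ} (hr0 : 0 < r)
    (hr : ∀ z ∈ μ.support, ‖z‖ ≤ r) (n : ℕ) {z : ℂ} (hz : r ≤ ‖z‖) :
    ((‖z‖ - r) / r) ^ n ≤ ‖(orthoPoly μ n).eval z‖ := by
  rw [norm_eval_orthoPoly, div_pow, div_eq_inv_mul]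
  have h1 := pow_sub_le_norm_eval_monicOrthoPoly hc hinf hr n hz
  have h2 := sqrt_integral_monicOrthoPoly_le hc hinf hr0.le hr n
  have h3 := Real.sqrt_pos.2 (integral_norm_sq_pos hc hinf (monicOrthoPoly_monic μ n).1.ne_zero)
  have h4 := sub_nonneg.2 hz
  gcongr

theorem norm_lt_of_mem_filledJulia {P : ℂ[X]} {R : ℝ} (hR : 1 ≤ R)
    (hP : ∀ z : ℂ, R ≤ ‖z‖ → 2 * ‖z‖ ≤ ‖P.eval z‖) {z : ℂ} (hz : z ∈ filledJulia P) : ‖z‖ < R := by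
  by_contra! hle
  refine hz (tendsto_norm_atTop_iff_cobounded.1 ?_)
  have key : ∀ k : ℕ, R * 2 ^ k ≤ ‖(fun w => P.eval w)^[k] z‖ := by
    intro k
    induction k with
    | zero => simpa using hle
    | succ k ih =>
      rw [Function.iterate_succ_apply']
      have h1 : R ≤ R * 2 ^ k := le_mul_of_one_le_right (by linarith) (one_le_pow₀ (by norm_num))
      have h2 := hP _ (h1.trans ih)
      rw [pow_succ]
      linarith
  exact tendsto_atTop_mono key
    ((tendsto_pow_atTop_atTop_of_one_lt (by norm_num)).const_mul_atTop (by linarith))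

/-- The filled Julia sets of the orthonormal polynomials of degree at least two are uniformly
bounded. -/
theorem exists_norm_lt_of_mem_filledJulia_orthoPoly {μ : Measure ℂ} [IsProbabilityMeasure μ]
    (hc : IsCompact μ.support) (hinf : μ.support.Infinite) :
    ∃ R : ℝ, ∀ n : ℕ, 2 ≤ n → ∀ z ∈ filledJulia (orthoPoly μ n), ‖z‖ < R := by
  obtain ⟨r₀, hr₀⟩ := isBounded_iff_forall_norm_le.1 hc.isBounded
  set r := max r₀ 1 with hr
  have hr1 : 1 ≤ r := le_max_right _ _
  have hrS : ∀ z ∈ μ.support, ‖z‖ ≤ r := fun z hz => (hr₀ z hz).trans (le_max_left _ _)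
  -- Beyond this radius `t = (‖z‖ - r)/r` satisfies `t ≥ 4r ≥ 4`, so `t ^ n ≥ t² ≥ 4rt ≥ 2r(t + 1) =
  -- 2‖z‖`. The first inequality uses `n ≥ 2`.
  refine ⟨r * (4 * r + 1), fun n hn z hz => norm_lt_of_mem_filledJulia (by nlinarith) ?_ hz⟩
  intro z hz
  refine le_trans ?_ (pow_le_norm_eval_orthoPoly hc hinf (by linarith) hrS n (by nlinarith))
  set t := (‖z‖ - r) / r with ht
  have hzt : ‖z‖ = r * (t + 1) := by rw [ht]; field_simp; ring
  have ht4 : 4 * r ≤ t := by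
    rw [hzt] at hz
    have := le_of_mul_le_mul_left hz (by linarith)
    linarith
  refine le_trans ?_ (pow_le_pow_right₀ (by linarith) hn)
  rw [hzt]
  nlinarith

/-! ### Counting solutions in `V` -/

/-- The leading coefficient `γ_n` is the reciprocal of the minimal monic norm. -/
theorem one_le_integral_norm_sq {μ : Measure ℂ} [IsFiniteMeasure μ]
    (hc : IsCompact μ.support) (hinf : μ.support.Infinite) {n : ℕ} {p : ℂ[X]} (hp : p.Monic)
    (hpn : p.natDegree = n) :
    1 ≤ ∫ z, ‖(orthoPoly μ n).leadingCoeff * p.eval z‖ ^ 2 ∂μ := by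
  have hpos := integral_norm_sq_pos hc hinf (monicOrthoPoly_monic μ n).1.ne_zero
  have hle := integral_norm_sq_monicOrthoPoly_le hc hinf hp hpn
  simp only [norm_mul, mul_pow]
  rw [integral_const_mul, orthoPoly, leadingCoeff_mul, leadingCoeff_C,
    (monicOrthoPoly_monic μ n).1.leadingCoeff, mul_one,
    Complex.norm_of_nonneg (inv_nonneg.2 (Real.sqrt_nonneg _)), inv_pow, Real.sq_sqrt hpos.le]
  rwa [one_le_inv_mul₀ hpos]

theorem integral_norm_sq_orthoPoly {μ : Measure ℂ} [IsFiniteMeasure μ]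
    (hc : IsCompact μ.support) (hinf : μ.support.Infinite) (n : ℕ) :
    ∫ z, ‖(orthoPoly μ n).eval z‖ ^ 2 ∂μ = 1 := by
  have h := (orthoPoly_spec hc hinf).2 n n
  rw [if_pos rfl, polyInner_self] at h
  exact_mod_cast h

theorem integral_norm_sq_orthoPoly_sub_C_le {μ : Measure ℂ} [IsProbabilityMeasure μ]
    (hc : IsCompact μ.support) (hinf : μ.support.Infinite) (n : ℕ) (c : ℂ) :
    ∫ z, ‖(orthoPoly μ n - C c).eval z‖ ^ 2 ∂μ ≤ 2 * (1 + ‖c‖ ^ 2) := by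
  have hint : Integrable (fun z => ‖(orthoPoly μ n).eval z‖ ^ 2) μ :=
    integrable_of_continuous hc ((orthoPoly μ n).continuous.norm.pow 2)
  calc ∫ z, ‖(orthoPoly μ n - C c).eval z‖ ^ 2 ∂μ
      ≤ ∫ z, 2 * (‖(orthoPoly μ n).eval z‖ ^ 2 + ‖c‖ ^ 2) ∂μ := by
        refine integral_mono
          (integrable_of_continuous hc ((orthoPoly μ n - C c).continuous.norm.pow 2))
          ((hint.add (integrable_const _)).const_mul 2) fun z => ?_
        have h1 : ‖(orthoPoly μ n - C c).eval z‖ ≤ ‖(orthoPoly μ n).eval z‖ + ‖c‖ := by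
          rw [eval_sub, eval_C]
          exact norm_sub_le _ _
        have h2 := pow_le_pow_left₀ (norm_nonneg _) h1 2
        simp only
        nlinarith [sq_nonneg (‖(orthoPoly μ n).eval z‖ - ‖c‖)]
    _ = _ := by
        rw [integral_const_mul, integral_add hint (integrable_const _),
          integral_norm_sq_orthoPoly hc hinf]
        simp

open Classical in
/-- The number of solutions of `P_n(w) = c` in a compact subset of the unbounded component of the
complement of the support is bounded uniformly in `n ≥ 1` and in `c` from a bounded set. -/
theorem exists_preimageCount_lt {μ : Measure ℂ} [IsProbabilityMeasure μ]
    (hc : IsCompact μ.support) (hinf : μ.support.Infinite) {V : Set ℂ} (hV : IsCompact V)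
    (hVS : V ⊆ unboundedComponent μ.support) (R : ℝ) :
    ∃ M : ℕ, ∀ n : ℕ, 1 ≤ n → ∀ c : ℂ, ‖c‖ ≤ R → preimageCount (orthoPoly μ n) c V < M := by
  obtain ⟨L, hL⟩ := exists_monic_norm_eval_le_half_pow hc hV hVS
  -- The factor `(1/2)^k` gained on `S` is squared in the integral; `k` is chosen so that it beats
  -- the bound `2(1 + R²)` for the squared norm of `P_n - c`.
  obtain ⟨k, hk⟩ := exists_pow_lt_of_lt_one (y := (1 / 4 : ℝ))
    (show 0 < (2 * (1 + R ^ 2))⁻¹ by positivity) (by norm_num)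
  refine ⟨k * L + 1, fun n hn c hcR => ?_⟩
  by_contra! hcon
  obtain ⟨hdeg, γ, hγ, hlead⟩ := (orthoPoly_spec hc hinf).1 n
  set P := orthoPoly μ n - C c with hP
  have hPdeg : P.natDegree = n := by rw [hP, natDegree_sub_C, hdeg]
  have hPlead : P.leadingCoeff = (orthoPoly μ n).leadingCoeff := by
    rw [hP, leadingCoeff_sub_of_degree_lt]
    exact degree_C_le.trans_lt (natDegree_pos_iff_degree_pos.1 (by omega))
  have hcard : P.roots.card = P.natDegree :=
    (IsAlgClosed.splits P).natDegree_eq_card_roots.symm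
  have hfac := C_leadingCoeff_mul_prod_multiset_X_sub_C hcard
  set s := P.roots.filter (· ∈ V) with hs
  set t := P.roots.filter (fun x => ¬ x ∈ V) with ht
  have hst : s + t = P.roots := Multiset.filter_add_not _ _
  -- The zeros in `V` are exchanged for those of `q`; the zeros outside `V`, collected in `t`, are
  -- kept.
  obtain ⟨q, hq, hqd, hqS⟩ := hL k s (fun x hx => (Multiset.mem_filter.1 hx).2) (by
    rw [preimageCount, Multiset.countP_eq_card_filter, ← hP, ← hs] at hcon
    omega)
  set Q := q * (t.map fun x => X - C x).prod with hQ
  have htm : (t.map fun x => X - C x).prod.Monic :=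
    monic_multiset_prod_of_monic _ _ fun x _ => monic_X_sub_C x
  have hQd : Q.natDegree = n := by
    rw [hQ, hq.natDegree_mul htm, natDegree_multiset_prod_X_sub_C_eq_card, hqd,
      ← Multiset.card_add, hst, hcard, hPdeg]
  have h1 := one_le_integral_norm_sq hc hinf (hq.mul htm) hQd
  have hle : ∀ z ∈ μ.support, ‖(orthoPoly μ n).leadingCoeff * Q.eval z‖ ^ 2 ≤
      (1 / 4) ^ k * ‖P.eval z‖ ^ 2 := by
    intro z hz
    have e1 : ‖P.eval z‖ = ‖(orthoPoly μ n).leadingCoeff‖ *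
        ((s.map fun x => ‖z - x‖).prod * (t.map fun x => ‖z - x‖).prod) := by
      rw [← hfac, eval_mul, eval_C, norm_mul, hPlead, norm_eval_multiset_prod_X_sub_C, ← hst,
        Multiset.map_add, Multiset.prod_add]
    have e2 : ‖(orthoPoly μ n).leadingCoeff * Q.eval z‖ ≤ (1 / 2) ^ k * ‖P.eval z‖ := by
      rw [e1, hQ, eval_mul, norm_mul, norm_mul, norm_eval_multiset_prod_X_sub_C]
      have h := hqS z hz
      have hnn : 0 ≤ (t.map fun x => ‖z - x‖).prod := by
        rw [← norm_eval_multiset_prod_X_sub_C]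
        exact norm_nonneg _
      calc _ ≤ ‖(orthoPoly μ n).leadingCoeff‖ *
            ((1 / 2) ^ k * (s.map fun x => ‖z - x‖).prod * (t.map fun x => ‖z - x‖).prod) := by
            gcongr
        _ = _ := by ring
    calc _ ≤ ((1 / 2) ^ k * ‖P.eval z‖) ^ 2 := pow_le_pow_left₀ (norm_nonneg _) e2 2
      _ = _ := by rw [mul_pow, ← pow_mul, mul_comm k, pow_mul]; norm_num
  have h2 : ∫ z, ‖(orthoPoly μ n).leadingCoeff * Q.eval z‖ ^ 2 ∂μ ≤
      (1 / 4) ^ k * ∫ z, ‖P.eval z‖ ^ 2 ∂μ := by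
    rw [← integral_const_mul]
    refine integral_mono_ae
      (integrable_of_continuous hc ((continuous_const.mul Q.continuous).norm.pow 2))
      ((integrable_of_continuous hc (P.continuous.norm.pow 2)).const_mul _) ?_
    filter_upwards [Measure.support_mem_ae (μ := μ)] with z hz using hle z hz
  have h3 := integral_norm_sq_orthoPoly_sub_C_le hc hinf n c
  have h4 : (2 : ℝ) * (1 + ‖c‖ ^ 2) ≤ 2 * (1 + R ^ 2) := by gcongr
  have h5 : (1 / 4 : ℝ) ^ k * ∫ z, ‖P.eval z‖ ^ 2 ∂μ < 1 := by
    calc _ ≤ (1 / 4 : ℝ) ^ k * (2 * (1 + R ^ 2)) := by gcongr; exact h3.trans h4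
      _ < (2 * (1 + R ^ 2))⁻¹ * (2 * (1 + R ^ 2)) := by gcongr
      _ = 1 := inv_mul_cancel₀ (by positivity)
  linarith

open Classical in
theorem encard_preimage_inter_le_preimageCount {P : ℂ[X]} {c : ℂ} (hP : P - C c ≠ 0) (V : Set ℂ) :
    ((fun w => P.eval w) ⁻¹' {c} ∩ V).encard ≤ preimageCount P c V := by
  have hsub : (fun w => P.eval w) ⁻¹' {c} ∩ V ⊆
      (((P - C c).roots.filter (· ∈ V)).toFinset : Set ℂ) := by
    rintro w ⟨hw, hwV⟩
    have hw' : P.eval w = c := hw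
    simp only [Multiset.toFinset_filter, Finset.coe_filter, Multiset.mem_toFinset,
      Set.mem_ofPred_eq]
    exact ⟨(mem_roots hP).2 (by simp [hw']), hwV⟩
  refine (Set.encard_le_encard hsub).trans ?_
  rw [Set.encard_coe_eq_coe_finsetCard, preimageCount, Multiset.countP_eq_card_filter]
  exact_mod_cast Multiset.toFinset_card_le _

end OrthoJulia

theorem mainTheorem3 (μ : Measure ℂ) (hμ : μ ∈ OrthoJulia.classB) (V : Set ℂ) (hV : IsCompact V)
    (hVK : V ∩ OrthoJulia.filled μ.support = ∅) :
    ∃ M : ℕ, ∀ n : ℕ, 2 ≤ n → ∀ z ∈ OrthoJulia.filledJulia (OrthoJulia.orthoPoly μ n),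
      OrthoJulia.preimageCount (OrthoJulia.orthoPoly μ n) z V < M ∧
      ((fun w => (OrthoJulia.orthoPoly μ n).eval w) ⁻¹' {z} ∩ V).encard < M := by
  have hinf := OrthoJulia.support_infinite_of_mem_classB hμ
  obtain ⟨hprob, hc, -⟩ := hμ
  have hVS : V ⊆ OrthoJulia.unboundedComponent μ.support := fun w hw => by
    by_contra h
    exact Set.notMem_empty w (hVK ▸ ⟨hw, h⟩)
  obtain ⟨R, hR⟩ := OrthoJulia.exists_norm_lt_of_mem_filledJulia_orthoPoly hc hinf
  obtain ⟨M, hM⟩ := OrthoJulia.exists_preimageCount_lt hc hinf hV hVS R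
  refine ⟨M, fun n hn z hz => ?_⟩
  have hlt := hM n (by omega) z (hR n hn z hz).le
  -- The zero polynomial has an empty root multiset, so nonvanishing is needed for the multiplicity
  -- count to dominate the number of points.
  have hne : OrthoJulia.orthoPoly μ n - C z ≠ 0 := fun h => by
    have h1 := ((OrthoJulia.orthoPoly_spec hc hinf).1 n).1
    rw [← natDegree_sub_C (a := z), h, natDegree_zero] at h1
    omega
  exact ⟨hlt, (OrthoJulia.encard_preimage_inter_le_preimageCount hne V).trans_lt
    (by exact_mod_cast hlt)⟩
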